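/- There is a universal constant $C>0$ with the following property. Let $\Lambda$ be a finite set of sites with a (pseudo)metric ${\rm dist}$, let the Hilbert space be $\bigotimes_{i\in\Lambda}\mathbb{C}^{d_i}$, and let $H=\sum_{Z\subseteq\Lambda}H_Z$ be a Hamiltonian with each $H_Z$ Hermitian and supported on $Z$ (an operator is supported on $Z$ if it has the form $P\otimes I_{\Lambda\setminus Z}$). Write $O(t)=e^{iHt}Oe^{-iHt}$, let $\|\cdot\|$ be the operator norm, and let ${\rm dist}(X,Y)=\min_{i\in X,\,j\in Y}{\rm dist}(i,j)$ for nonempty $X,Y\subseteq\Lambda$. Suppose that $H$ satisfies a Lieb–Robinson bound with velocity $v_{LR}>0$ and a function $g\ge 0$ on $[0,\infty)$: for all nonempty $X,Y$ with $l={\rm dist}(X,Y)>0$, all operators $A_X,B_Y$ supported on $X,Y$ respectively, and all real $t$ with $|t|\le l/v_{LR}$, $$\|[A_X(t),B_Y]\|\le \frac{v_{LR}|t|}{l}\,g(l)\,|X|\,\|A_X\|\,\|B_Y\|.$$ Let $\Delta E>0$, let $X,Y\subseteq\Lambda$ be nonempty, let $l={\rm dist}(X,Y)\ge 0$, and let $A_X,B_Y$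 be operators supported on $X,Y$ respectively. (1) Unique ground state. Suppose that $H$ has a unique ground state $\psi_0$ (normalized, with energy $E_0$) and a spectral gap of at least $\Delta E$, that is, every eigenvector of $H$ orthogonal to $\psi_0$ has energy at least $E_0+\Delta E$. Then $$\bigl|\langle\psi_0,A_XB_Y\psi_0\rangle-\langle\psi_0,A_X\psi_0\rangle\langle\psi_0,B_Y\psi_0\rangle\bigr|\le C\Bigl\{e^{-l\Delta E/2v_{LR}}+\min(|X|,|Y|)\,g(l)\Bigr\}\|A_X\|\,\|B_Y\|.$$ (2) Several ground states. Suppose that $\psi_0^1,\dots,\psi_0^k$ are orthonormal eigenvectors of $H$ with energies $E_0^1,\dots,E_0^k$, that $|E_0^b-E_0^c|\le\delta$ for all $b,c$, and that every eigenvector of $H$ orthogonal to all of them has energy at least $E_0^a+\Delta E$ for every $a$. Let $P_0=\sum_a|\psi_0^a\rangle\langle\psi_0^a|$. Then, for every $a$, $$\bigl|\langle\psi_0^a,A_XB_Y\psi_0^a\rangle-\langle\psi_0^a,A_XP_0B_Y\psi_0^a\rangle\bigr|\le C\Bigl\{e^{-l\Delta E/2v_{LR}}+\min(|X|,|Y|)\,g(l)\Bigr\}\|A_X\|\,\|B_Y\|+C\,\frac{\delta}{\Delta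 E}\sqrt{\frac{l\,\Delta E}{v_{LR}}}\;\|A_X\|\,\|B_Y\|.$$ -/

import Mathlib

namespace QuantumLattice

/-- The Hilbert space `⨂_{i ∈ Λ} ℂ^(d i)` of a finite quantum lattice system, realised as `ℓ²` of
the set of product-basis labels. -/
abbrev HSpace {Λ : Type*} [Fintype Λ] [DecidableEq Λ] (d : Λ → ℕ) : Type _ :=
  EuclideanSpace ℂ ((i : Λ) → Fin (d i))

/-- Operators on the Hilbert space of the system, with the operator norm. -/
abbrev Op {Λ : Type*} [Fintype Λ] [DecidableEq Λ] (d : Λ → ℕ) : Type _ :=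
  HSpace d →L[ℂ] HSpace d

/-- The matrix of `P ⊗ I_{Λ ∖ X}` in the product basis, for a matrix `P` on the sites in `X`. -/
def extendMatrix {Λ : Type*} [Fintype Λ] [DecidableEq Λ] (d : Λ → ℕ) (X : Finset Λ)
    (P : Matrix ((i : X) → Fin (d i)) ((i : X) → Fin (d i)) ℂ) :
    Matrix ((i : Λ) → Fin (d i)) ((i : Λ) → Fin (d i)) ℂ :=
  Matrix.of fun s s' =>
    if ∀ i, i ∉ X → s i = s' i then P (fun i => s i) (fun i => s' i) else 0

/-- `O` is supported on `X`: it is of the form `P ⊗ I_{Λ ∖ X}`. -/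
def SupportedOn {Λ : Type*} [Fintype Λ] [DecidableEq Λ] {d : Λ → ℕ} (X : Finset Λ)
    (O : Op d) : Prop :=
  ∃ P : Matrix ((i : X) → Fin (d i)) ((i : X) → Fin (d i)) ℂ,
    O = Matrix.toEuclideanCLM (𝕜 := ℂ) (extendMatrix d X P)

/-- `dist(X, Y) = min_{i ∈ X, j ∈ Y} dist(i, j)` (used for nonempty sets). -/
noncomputable def setDist {Λ : Type*} [PseudoMetricSpace Λ] (X Y : Finset Λ) : ℝ :=
  ⨅ p : X × Y, dist (p.1 : Λ) (p.2 : Λ)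

/-- The terms `H_Z` of a lattice Hamiltonian `H = ∑_Z H_Z`: Hermitian, with `H_Z` supported
on `Z`. -/
structure Interaction {Λ : Type*} [Fintype Λ] [DecidableEq Λ] (d : Λ → ℕ) where
  term : Finset Λ → Op d
  selfAdjoint : ∀ Z, IsSelfAdjoint (term Z)
  supported : ∀ Z, SupportedOn Z (term Z)

/-- The Hamiltonian `H = ∑_Z H_Z`. -/
noncomputable def Interaction.hamiltonian {Λ : Type*} [Fintype Λ] [DecidableEq Λ] {d : Λ → ℕ}
    (Φ : Interaction d) : Op d :=
  ∑ Z : Finset Λ, Φ.term Z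

/-- The Heisenberg evolution `O(t) = exp(iHt) O exp(-iHt)`. -/
noncomputable def heisenberg {Λ : Type*} [Fintype Λ] [DecidableEq Λ] {d : Λ → ℕ}
    (H : Op d) (t : ℝ) (O : Op d) : Op d :=
  NormedSpace.exp ((Complex.I * (t : ℂ)) • H) * O *
    NormedSpace.exp (-((Complex.I * (t : ℂ)) • H))

/-- The Lieb–Robinson bound with velocity `v` and decay function `g`: for operators supported on
sets at distance `l > 0` and for `|t| ≤ l / v`,
`‖[A_X(t), B_Y]‖ ≤ (v |t| / l) g(l) |X| ‖A_X‖ ‖B_Y‖`. -/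
def HasLiebRobinsonBound {Λ : Type*} [Fintype Λ] [DecidableEq Λ] [PseudoMetricSpace Λ]
    {d : Λ → ℕ} (H : Op d) (v : ℝ) (g : ℝ → ℝ) : Prop :=
  ∀ (X Y : Finset Λ), X.Nonempty → Y.Nonempty → 0 < setDist X Y →
    ∀ (A B : Op d), SupportedOn X A → SupportedOn Y B →
      ∀ t : ℝ, |t| ≤ setDist X Y / v →
        ‖heisenberg H t A * B - B * heisenberg H t A‖ ≤
          v * |t| / setDist X Y * g (setDist X Y) * (X.card : ℝ) * ‖A‖ * ‖B‖

/-- `ψ₀` is a normalised eigenvector of `H` with energy `E₀`, and every eigenvector orthogonal to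
it has energy at least `E₀ + ΔE`.  For `ΔE > 0`, this says that `ψ₀` is the unique ground state
of the Hermitian operator `H`, with spectral gap (at least) `ΔE`. -/
def IsUniqueGroundState {Λ : Type*} [Fintype Λ] [DecidableEq Λ] {d : Λ → ℕ}
    (H : Op d) (E₀ : ℝ) (ψ₀ : HSpace d) (ΔE : ℝ) : Prop :=
  ‖ψ₀‖ = 1 ∧ H ψ₀ = (E₀ : ℂ) • ψ₀ ∧
    ∀ (e : ℝ) (φ : HSpace d), φ ≠ 0 → H φ = (e : ℂ) • φ → inner ℂ ψ₀ φ = 0 → E₀ + ΔE ≤ e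

/-- `ψ 0, …, ψ (k-1)` are orthonormal eigenvectors of `H` with energies `E 0, …, E (k-1)` (possibly
different), and every eigenvector orthogonal to all of them has energy at least `E a + ΔE` for
each `a`. -/
def AreGroundStates {Λ : Type*} [Fintype Λ] [DecidableEq Λ] {d : Λ → ℕ} {k : ℕ}
    (H : Op d) (E : Fin k → ℝ) (ψ : Fin k → HSpace d) (ΔE : ℝ) : Prop :=
  Orthonormal ℂ ψ ∧ (∀ a, H (ψ a) = (E a : ℂ) • ψ a) ∧
    ∀ (e : ℝ) (φ : HSpace d), φ ≠ 0 → H φ = (e : ℂ) • φ → (∀ a, inner ℂ (ψ a) φ = 0) →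
      ∀ a, E a + ΔE ≤ e

/-- The projector `P₀ = ∑_a |ψ_a⟩⟨ψ_a|` onto the ground state subspace. -/
noncomputable def groundProjector {Λ : Type*} [Fintype Λ] [DecidableEq Λ] {d : Λ → ℕ} {k : ℕ}
    (ψ : Fin k → HSpace d) : Op d :=
  ∑ a, InnerProductSpace.rankOne ℂ (ψ a) (ψ a)

end QuantumLattice

/-! ### The Gaussian-smoothed step function. -/

namespace QuantumLattice

/-! Expand in an eigenbasis: with `p n = ⟨ψ, A bₙ⟩⟨bₙ, B ψ⟩`, `q n` the same with `A` and `B`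
exchanged, and `ω n` the excitation energies, `⟨ψ, [A, B(t)] ψ⟩` is `commutatorSum p q ω t`. The
correlation to be bounded is the sum of `p n` over the excited states.

A filter in time extracts this sum. Integrating the commutator against `exp (-t²) / (it)` weights `p
+ q` by a smoothed sign of `ω`; integrating it against `exp (-t²)` weights `p - q` by a Gaussian in
`ω`. Since `∑ p = ∑ q`, a combination of the two gives weights on `(p, q)` near `(1, 0)` above the
gap and near `(0, 0)` at `ω ≈ 0`. The second integral is what removes the ground states themselves.

Both integrals are small: Lieb–Robinson controls `|t| ≤ T` and the Gaussian tail controls the rest.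
Scaling time so that tail and filter errors are both `exp (-lΔE / 2v)` gives the rate. Ground
energies spread by `δ` cost an error linear in `δ` (`norm_sum_le_of_commutatorSum_le`,
`groundStates_clustering`). -/

/-- The odd part of the Gaussian-smoothed step function:
`(1 / 2) erf (ω / 2) = (2 √π)⁻¹ ∫ s in 0..ω, exp (-s² / 4)`. -/
noncomputable def halfErf (ω : ℝ) : ℝ :=
  (2 * √Real.pi)⁻¹ * ∫ s in (0 : ℝ)..ω, Real.exp (-(1 / 4) * s ^ 2)

theorem halfErf_neg (ω : ℝ) : halfErf (-ω) = -halfErf ω := by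
  have h := intervalIntegral.integral_comp_neg (a := 0) (b := ω)
    (fun s : ℝ => Real.exp (-(1 / 4) * s ^ 2))
  simp only [neg_sq, neg_zero] at h
  rw [halfErf, halfErf, h, intervalIntegral.integral_symm, mul_neg]

theorem one_le_sqrt_pi : 1 ≤ √Real.pi := by
  rw [Real.one_le_sqrt]; linarith [Real.pi_gt_three]

theorem abs_halfErf_le (ω : ℝ) : |halfErf ω| ≤ |ω| / 2 := by
  have h : ‖∫ s in (0 : ℝ)..ω, Real.exp (-(1 / 4) * s ^ 2)‖ ≤ 1 * |ω - 0| := by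
    refine intervalIntegral.norm_integral_le_of_norm_le_const fun s _ => ?_
    rw [Real.norm_of_nonneg (Real.exp_pos _).le, Real.exp_le_one_iff]
    nlinarith [sq_nonneg s]
  rw [halfErf, abs_mul, abs_of_nonneg (by positivity), ← Real.norm_eq_abs (∫ _ in _.._, _)]
  rw [sub_zero, one_mul] at h
  have h2 : (2 * √Real.pi)⁻¹ ≤ 2⁻¹ := by
    apply inv_anti₀ (by norm_num); linarith [one_le_sqrt_pi]
  calc _ ≤ 2⁻¹ * |ω| := mul_le_mul h2 h (norm_nonneg _) (by norm_num)
    _ = _ := by ring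

/-- The difference is a Gaussian tail; after shifting to start at `0`, `(s + ω)² ≥ s² + ω²` pulls
out the decay. -/
theorem abs_half_sub_halfErf_le {ω : ℝ} (hω : 0 ≤ ω) :
    |1 / 2 - halfErf ω| ≤ Real.exp (-(1 / 4) * ω ^ 2) / 2 := by
  have hint : MeasureTheory.Integrable fun s : ℝ => Real.exp (-(1 / 4) * s ^ 2) :=
    integrable_exp_neg_mul_sq (by norm_num)
  have hpi : 0 < √Real.pi := by positivity
  have h0 : ∫ s in Set.Ioi (0 : ℝ), Real.exp (-(1 / 4) * s ^ 2) = √Real.pi := by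
    rw [integral_gaussian_Ioi, show Real.pi / (1 / 4) = Real.pi * 2 ^ 2 by ring,
      Real.sqrt_mul Real.pi_pos.le, Real.sqrt_sq (by norm_num)]
    ring
  have hsplit := intervalIntegral.integral_interval_add_Ioi' (a := 0) (b := ω)
    (μ := MeasureTheory.volume)
    (f := fun s : ℝ => Real.exp (-(1 / 4) * s ^ 2)) hint.intervalIntegrable hint.integrableOn
  rw [h0] at hsplit
  have hshift : ∫ s in Set.Ioi ω, Real.exp (-(1 / 4) * s ^ 2)
      = ∫ s in Set.Ioi (0 : ℝ), Real.exp (-(1 / 4) * (s + ω) ^ 2) := by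
    have := (MeasureTheory.measurePreserving_add_right
      MeasureTheory.volume ω).setIntegral_preimage_emb (measurableEmbedding_addRight ω)
      (fun s : ℝ => Real.exp (-(1 / 4) * s ^ 2)) (Set.Ioi ω)
    simpa using this.symm
  have hle : ∫ s in Set.Ioi (0 : ℝ), Real.exp (-(1 / 4) * (s + ω) ^ 2)
      ≤ ∫ s in Set.Ioi (0 : ℝ), Real.exp (-(1 / 4) * ω ^ 2) * Real.exp (-(1 / 4) * s ^ 2) := by
    refine MeasureTheory.setIntegral_mono_on (hint.comp_add_right ω).integrableOn
      (hint.const_mul _).integrableOn measurableSet_Ioi fun s hs => ?_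
    rw [← Real.exp_add, Real.exp_le_exp]
    nlinarith [mul_nonneg (le_of_lt (Set.mem_Ioi.1 hs)) hω]
  rw [MeasureTheory.integral_const_mul, h0, ← hshift] at hle
  have hnn : 0 ≤ ∫ s in Set.Ioi ω, Real.exp (-(1 / 4) * s ^ 2) :=
    MeasureTheory.integral_nonneg fun s => (Real.exp_pos _).le
  have key : 1 / 2 - halfErf ω
      = (2 * √Real.pi)⁻¹ * ∫ s in Set.Ioi ω, Real.exp (-(1 / 4) * s ^ 2) := by
    rw [halfErf, eq_sub_iff_add_eq'.2 hsplit]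
    field_simp
  rw [key, abs_of_nonneg (by positivity)]
  calc _ ≤ (2 * √Real.pi)⁻¹ * (Real.exp (-(1 / 4) * ω ^ 2) * √Real.pi) := by gcongr
    _ = _ := by field_simp

/-! ### Gaussian Fourier integrals and tail bounds. -/

theorem integrable_exp_neg_sq : MeasureTheory.Integrable fun t : ℝ => Real.exp (-t ^ 2) := by
  simpa using integrable_exp_neg_mul_sq (b := 1) one_pos

theorem integrable_gaussian_mul_cexp (ω : ℝ) :
    MeasureTheory.Integrable fun t : ℝ =>
      (Real.exp (-t ^ 2) : ℂ) * Complex.exp (ω * t * Complex.I) := by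
  have h := integrable_exp_neg_sq
  refine h.mono' (by fun_prop) (.of_forall fun t => ?_)
  rw [norm_mul, ← Complex.ofReal_mul, Complex.norm_exp_ofReal_mul_I, mul_one, Complex.norm_real,
    Real.norm_of_nonneg (Real.exp_pos _).le]

theorem integral_gaussian_mul_cexp (ω : ℝ) :
    ∫ t : ℝ, (Real.exp (-t ^ 2) : ℂ) * Complex.exp (ω * t * Complex.I)
      = (√Real.pi * Real.exp (-(1 / 4) * ω ^ 2) : ℝ) := by
  have h := fourierIntegral_gaussian (b := 1) (by simp) (ω : ℂ)
  have hpi : ((Real.pi : ℂ) / 1) ^ (1 / 2 : ℂ) = (√Real.pi : ℝ) := by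
    rw [Real.sqrt_eq_rpow, Complex.ofReal_cpow Real.pi_pos.le]
    simp
  rw [hpi] at h
  rw [Complex.ofReal_mul, Complex.ofReal_exp]
  convert h using 2
  · ext t
    rw [mul_comm, Complex.ofReal_exp]
    congr 2
    · ring
    · push_cast; ring
  · push_cast; ring_nf

theorem norm_cexp_sub_one_div_le (ω t : ℝ) :
    ‖(Complex.exp (ω * t * Complex.I) - 1) / (t * Complex.I)‖ ≤ |ω| := by
  rcases eq_or_ne t 0 with rfl | ht
  · simp
  have h := @Real.norm_exp_I_mul_ofReal_sub_one_le (ω * t)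
  rw [norm_div, norm_mul, Complex.norm_I, mul_one, Complex.norm_real, div_le_iff₀ (by simpa)]
  rw [norm_mul, Complex.ofReal_mul, mul_comm Complex.I] at h
  exact h

theorem integrable_gaussian_mul_cexp_sub_one_div (ω : ℝ) :
    MeasureTheory.Integrable fun t : ℝ =>
      (Real.exp (-t ^ 2) : ℂ) * ((Complex.exp (ω * t * Complex.I) - 1) / (t * Complex.I)) := by
  have h := integrable_exp_neg_sq
  refine (h.mul_const |ω|).mono' (by fun_prop) (.of_forall fun t => ?_)
  rw [norm_mul, Complex.norm_real, Real.norm_of_nonneg (Real.exp_pos _).le]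
  gcongr
  exact norm_cexp_sub_one_div_le ω t

/-- The quotient is `∫ s in 0..ω, exp (ist)`, so Fubini reduces to the Fourier transform of the
Gaussian. Subtracting `1` avoids a principal value. -/
theorem integral_gaussian_mul_cexp_sub_one_div (ω : ℝ) :
    ∫ t : ℝ, (Real.exp (-t ^ 2) : ℂ) *
        ((Complex.exp (ω * t * Complex.I) - 1) / (t * Complex.I))
      = (2 * Real.pi * halfErf ω : ℝ) := by
  have hint := integrable_exp_neg_sq
  have hprod : MeasureTheory.Integrable (Function.uncurry fun s t : ℝ =>
      (Real.exp (-t ^ 2) : ℂ) * Complex.exp (s * t * Complex.I))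
      ((MeasureTheory.volume.restrict (Set.uIoc 0 ω)).prod MeasureTheory.volume) := by
    have h1 : MeasureTheory.Integrable (fun _ : ℝ => (1 : ℝ))
      (MeasureTheory.volume.restrict (Set.uIoc 0 ω)) :=
      MeasureTheory.integrableOn_const (by simp [Set.uIoc])
    refine (h1.mul_prod hint).mono' (by fun_prop) (.of_forall fun z => ?_)
    simp only [Function.uncurry]
    rw [norm_mul, ← Complex.ofReal_mul, Complex.norm_exp_ofReal_mul_I, Complex.norm_real,
      Real.norm_of_nonneg (Real.exp_pos _).le]
    simp
  have hswap := MeasureTheory.intervalIntegral_integral_swap hprod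
  simp only [integral_gaussian_mul_cexp] at hswap
  have hpi : 0 < √Real.pi := by positivity
  have hl : ∫ s in (0 : ℝ)..ω, ((√Real.pi * Real.exp (-(1 / 4) * s ^ 2) : ℝ) : ℂ)
      = (2 * Real.pi * halfErf ω : ℝ) := by
    rw [intervalIntegral.integral_ofReal, intervalIntegral.integral_const_mul, halfErf]
    congr 1
    nth_rw 2 [← Real.mul_self_sqrt Real.pi_pos.le]
    field_simp
  rw [hl] at hswap
  rw [hswap]
  refine MeasureTheory.integral_congr_ae ?_
  -- At `t = 0` the quotient is `0` by convention, not `ω`.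
  filter_upwards [MeasureTheory.Measure.ae_ne MeasureTheory.volume (0 : ℝ)] with t ht
  rw [intervalIntegral.integral_const_mul]
  congr 1
  have hc : (t : ℂ) * Complex.I ≠ 0 := by simp [ht]
  have := integral_exp_mul_complex (a := 0) (b := ω) hc
  rw [Complex.ofReal_zero, mul_zero, Complex.exp_zero] at this
  rw [show (ω : ℂ) * t * Complex.I = t * Complex.I * ω by ring, ← this]
  refine intervalIntegral.integral_congr fun s _ => ?_
  congr 1; ring

theorem integral_exp_neg_sq : ∫ t : ℝ, Real.exp (-t ^ 2) = √Real.pi := by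
  simpa using integral_gaussian 1

/-- Outside `[-T, T]`, `t² ≥ T² + (|t| - T)²`. Two translated Gaussians cover both signs of `t`, and
their integrals over the whole line are explicit. -/
theorem exp_neg_sq_le_of_lt_abs {t T : ℝ} (hT : 0 ≤ T) (ht : T < |t|) :
    Real.exp (-t ^ 2) ≤
      Real.exp (-T ^ 2) * (Real.exp (-(t - T) ^ 2) + Real.exp (-(t + T) ^ 2)) := by
  rw [mul_add, ← Real.exp_add, ← Real.exp_add]
  rcases lt_abs.1 ht with h | h
  · refine le_add_of_le_of_nonneg (Real.exp_le_exp.2 ?_) (Real.exp_pos _).le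
    nlinarith
  · refine le_add_of_nonneg_of_le (Real.exp_pos _).le (Real.exp_le_exp.2 ?_)
    nlinarith

/-- A Gaussian-weighted integral of a function bounded by `a` on `[-T, T]` and by `b` elsewhere. -/
theorem norm_integral_gaussian_mul_le {h : ℝ → ℂ} {T a b : ℝ} (hT : 0 ≤ T) (ha : 0 ≤ a)
    (hb : 0 ≤ b) (h1 : ∀ t, |t| ≤ T → ‖h t‖ ≤ a) (h2 : ∀ t, T < |t| → ‖h t‖ ≤ b) :
    ‖∫ t : ℝ, (Real.exp (-t ^ 2) : ℂ) * h t‖ ≤ √Real.pi * (a + 2 * b * Real.exp (-T ^ 2)) := by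
  have i0 := integrable_exp_neg_sq
  have i1 := i0.comp_sub_right T
  have i2 := i0.comp_add_right T
  have i12 : MeasureTheory.Integrable fun t : ℝ =>
      b * Real.exp (-T ^ 2) * (Real.exp (-(t - T) ^ 2) + Real.exp (-(t + T) ^ 2)) :=
    (i1.add i2).const_mul _
  have hG : MeasureTheory.Integrable fun t : ℝ => a * Real.exp (-t ^ 2) +
      b * Real.exp (-T ^ 2) * (Real.exp (-(t - T) ^ 2) + Real.exp (-(t + T) ^ 2)) :=
    (i0.const_mul a).add i12
  refine (MeasureTheory.norm_integral_le_of_norm_le hG (.of_forall fun t => ?_)).trans_eq ?_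
  · rw [norm_mul, Complex.norm_real, Real.norm_of_nonneg (Real.exp_pos _).le]
    rcases le_or_gt |t| T with ht | ht
    · have := mul_le_mul_of_nonneg_left (h1 t ht) (Real.exp_pos (-t ^ 2)).le
      have h3 : 0 ≤ b * Real.exp (-T ^ 2) *
        (Real.exp (-(t - T) ^ 2) + Real.exp (-(t + T) ^ 2)) := by positivity
      linarith
    · have h3 : 0 ≤ a * Real.exp (-t ^ 2) := by positivity
      calc _ ≤ Real.exp (-T ^ 2) * (Real.exp (-(t - T) ^ 2) + Real.exp (-(t + T) ^ 2)) * b :=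
            mul_le_mul (exp_neg_sq_le_of_lt_abs hT ht) (h2 t ht) (norm_nonneg _) (by positivity)
        _ ≤ _ := by linarith
  · rw [MeasureTheory.integral_add (i0.const_mul a) i12,
      MeasureTheory.integral_const_mul, MeasureTheory.integral_const_mul,
      MeasureTheory.integral_add i1 i2,
      MeasureTheory.integral_sub_right_eq_self (fun t : ℝ => Real.exp (-t ^ 2)) T,
      MeasureTheory.integral_add_right_eq_self (fun t : ℝ => Real.exp (-t ^ 2)) T,
      integral_exp_neg_sq]
    ring

theorem one_sub_exp_neg_sq_le {x : ℝ} (hx : 0 ≤ x) : 1 - Real.exp (-x ^ 2) ≤ x := by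
  rcases le_or_gt x 1 with h | h
  · nlinarith [Real.add_one_le_exp (-x ^ 2)]
  · linarith [Real.exp_pos (-x ^ 2)]

/-! ### Filtering exponential sums. -/

section

variable {ι : Type*} [Fintype ι] {p q : ι → ℂ} {ω : ι → ℝ}

/-- The exponential sum `∑ₙ pₙ exp (i ωₙ t) - qₙ exp (-i ωₙ t)`. -/
noncomputable def commutatorSum (p q : ι → ℂ) (ω : ι → ℝ) (t : ℝ) : ℂ :=
  ∑ n, (p n * Complex.exp (ω n * t * Complex.I) - q n * Complex.exp ((-ω n : ℝ) * t * Complex.I))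

theorem norm_commutatorSum_le {M : ℝ} (hp : ∑ n, ‖p n‖ ≤ M) (hq : ∑ n, ‖q n‖ ≤ M) (t : ℝ) :
    ‖commutatorSum p q ω t‖ ≤ 2 * M := by
  have hn : ∀ x : ℝ, ‖Complex.exp (x * t * Complex.I)‖ = 1 := fun x => by
    rw [← Complex.ofReal_mul, Complex.norm_exp_ofReal_mul_I]
  calc _ ≤ ∑ n, (‖p n‖ + ‖q n‖) := norm_sum_le_of_le _ fun n _ => by
        refine (norm_sub_le _ _).trans_eq ?_
        rw [norm_mul, norm_mul, hn, hn, mul_one, mul_one]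
    _ ≤ _ := by rw [Finset.sum_add_distrib]; linarith

/-- The transform of the Gaussian is even, so `p` and `q` keep opposite signs. -/
theorem integral_gaussian_mul_commutatorSum :
    ∫ t : ℝ, (Real.exp (-t ^ 2) : ℂ) * commutatorSum p q ω t =
      √Real.pi * ∑ n, (p n - q n) * (Real.exp (-(1 / 4) * ω n ^ 2) : ℝ) := by
  have h : ∀ t : ℝ, (Real.exp (-t ^ 2) : ℂ) * commutatorSum p q ω t =
      ∑ n, (p n * ((Real.exp (-t ^ 2) : ℂ) * Complex.exp (ω n * t * Complex.I)) -
        q n * ((Real.exp (-t ^ 2) : ℂ) * Complex.exp ((-ω n : ℝ) * t * Complex.I))) := fun t => by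
    rw [commutatorSum, Finset.mul_sum]
    exact Finset.sum_congr rfl fun n _ => by ring
  simp_rw [h]
  rw [MeasureTheory.integral_finsetSum, Finset.mul_sum]
  swap
  · exact fun n _ => ((integrable_gaussian_mul_cexp (ω n)).const_mul (p n)).sub
      ((integrable_gaussian_mul_cexp (-ω n)).const_mul (q n))
  refine Finset.sum_congr rfl fun n _ => ?_
  rw [MeasureTheory.integral_sub ((integrable_gaussian_mul_cexp (ω n)).const_mul (p n))
      ((integrable_gaussian_mul_cexp (-ω n)).const_mul (q n)),
    MeasureTheory.integral_const_mul, MeasureTheory.integral_const_mul,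
    integral_gaussian_mul_cexp, integral_gaussian_mul_cexp, neg_sq]
  push_cast
  ring

/-- By `h0` every exponential may be replaced by itself minus `1`, which removes the pole. Oddness
of `halfErf` turns `p - q` into `p + q`. -/
theorem integral_gaussian_mul_commutatorSum_div (h0 : commutatorSum p q ω 0 = 0) :
    ∫ t : ℝ, (Real.exp (-t ^ 2) : ℂ) * (commutatorSum p q ω t / (t * Complex.I)) =
      (2 * Real.pi : ℝ) * ∑ n, (p n + q n) * (halfErf (ω n) : ℝ) := by
  have h : ∀ t : ℝ, (Real.exp (-t ^ 2) : ℂ) * (commutatorSum p q ω t / (t * Complex.I)) =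
      ∑ n, (p n * ((Real.exp (-t ^ 2) : ℂ) *
          ((Complex.exp (ω n * t * Complex.I) - 1) / (t * Complex.I))) -
        q n * ((Real.exp (-t ^ 2) : ℂ) *
          ((Complex.exp ((-ω n : ℝ) * t * Complex.I) - 1) / (t * Complex.I)))) := fun t => by
    have h1 : commutatorSum p q ω t = ∑ n, (p n * (Complex.exp (ω n * t * Complex.I) - 1) -
        q n * (Complex.exp ((-ω n : ℝ) * t * Complex.I) - 1)) := by
      rw [← sub_zero (commutatorSum p q ω t), ← h0, commutatorSum, commutatorSum,
        ← Finset.sum_sub_distrib]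
      refine Finset.sum_congr rfl fun n _ => ?_
      simp only [Complex.ofReal_zero, mul_zero, zero_mul, Complex.exp_zero]
      ring
    rw [h1, Finset.sum_div, Finset.mul_sum]
    exact Finset.sum_congr rfl fun n _ => by ring
  simp_rw [h]
  have hi := integrable_gaussian_mul_cexp_sub_one_div
  rw [MeasureTheory.integral_finsetSum, Finset.mul_sum]
  swap
  · exact fun n _ => ((hi (ω n)).const_mul (p n)).sub ((hi (-ω n)).const_mul (q n))
  refine Finset.sum_congr rfl fun n _ => ?_
  rw [MeasureTheory.integral_sub ((hi (ω n)).const_mul (p n)) ((hi (-ω n)).const_mul (q n)),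
    MeasureTheory.integral_const_mul, MeasureTheory.integral_const_mul,
    integral_gaussian_mul_cexp_sub_one_div, integral_gaussian_mul_cexp_sub_one_div, halfErf_neg]
  push_cast
  ring

/-- If the exponential sum is small at times `|t| ≤ T`, then the part of `∑ₙ pₙ` with frequencies
at least `D` is small, provided that all other frequencies are close to zero. -/
theorem norm_sum_le_of_commutatorSum_le [DecidableEq ι] {S : Finset ι} {M κ T D δ : ℝ}
    (hp : ∑ n, ‖p n‖ ≤ M) (hq : ∑ n, ‖q n‖ ≤ M) (hκ : 0 ≤ κ) (hT : 1 / 2 ≤ T) (hD : 0 ≤ D)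
    (hf : ∀ t, |t| ≤ T → ‖commutatorSum p q ω t‖ ≤ M * κ * |t| / T)
    (hS : ∀ n ∈ S, D ≤ ω n) (hδ : 0 ≤ δ) (hSc : ∀ n ∉ S, |ω n| ≤ δ) :
    ‖∑ n ∈ S, p n‖ ≤ M * (2 * κ + 8 * Real.exp (-T ^ 2) +
      2 * Real.exp (-(1 / 4) * D ^ 2) + 2 * δ) := by
  have hM : 0 ≤ M := (Finset.sum_nonneg fun n _ => norm_nonneg (p n)).trans hp
  have hT0 : 0 < T := by linarith
  -- The bound `hf` vanishes at `t = 0`.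
  have h0 : commutatorSum p q ω 0 = 0 := by
    have := hf 0 (by simpa using hT0.le)
    simpa using this
  set I : ℂ := ∑ n, (p n + q n) * (halfErf (ω n) : ℝ) with hI
  set J : ℂ := ∑ n, (p n - q n) * (Real.exp (-(1 / 4) * ω n ^ 2) : ℝ) with hJ
  have hpi := one_le_sqrt_pi
  have hJle : ‖J‖ ≤ M * κ + 4 * M * Real.exp (-T ^ 2) := by
    have h := norm_integral_gaussian_mul_le (h := commutatorSum p q ω) (a := M * κ) (b := 2 * M)
      hT0.le (by positivity) (by positivity)
      (fun t ht => (hf t ht).trans <| by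
        rw [mul_div_assoc]
        exact mul_le_of_le_one_right (by positivity) ((div_le_one hT0).2 ht))
      (fun t _ => norm_commutatorSum_le hp hq t)
    rw [integral_gaussian_mul_commutatorSum, norm_mul, Complex.norm_real,
      Real.norm_of_nonneg (by positivity)] at h
    have := le_of_mul_le_mul_left h (by positivity)
    linarith
  have hIle : ‖I‖ ≤ M * κ + 4 * M * Real.exp (-T ^ 2) := by
    have h := norm_integral_gaussian_mul_le (h := fun t => commutatorSum p q ω t / (t * Complex.I))
      (a := M * κ / T) (b := 2 * M / T)
      hT0.le (by positivity) (by positivity)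
      (fun t ht => by
        rcases eq_or_ne t 0 with rfl | h
        · simp; positivity
        · rw [norm_div, norm_mul, Complex.norm_I, mul_one, Complex.norm_real, Real.norm_eq_abs,
            div_le_iff₀ (by positivity)]
          exact (hf t ht).trans_eq (by ring))
      (fun t ht => by
        rw [norm_div, norm_mul, Complex.norm_I, mul_one, Complex.norm_real, Real.norm_eq_abs]
        gcongr
        exact norm_commutatorSum_le hp hq t)
    rw [integral_gaussian_mul_commutatorSum_div h0, norm_mul, Complex.norm_real,
      Real.norm_of_nonneg (by positivity)] at h
    have e : √Real.pi * (M * κ / T + 2 * (2 * M / T) * Real.exp (-T ^ 2)) =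
        √Real.pi * (1 / T) * (M * κ + 4 * M * Real.exp (-T ^ 2)) := by ring
    -- The kernel `1 / t` costs a factor `1 / T`; this is where `1 / 2 ≤ T` enters.
    have hT2 : 1 / T ≤ 2 := by rw [div_le_iff₀ hT0]; linarith
    have hpp : √Real.pi ≤ Real.pi := by
      nlinarith [Real.mul_self_sqrt Real.pi_pos.le]
    have : √Real.pi * (1 / T) ≤ 2 * Real.pi := by
      calc _ ≤ Real.pi * 2 := by gcongr
        _ = _ := by ring
    rw [e] at h
    have h' := h.trans (mul_le_mul_of_nonneg_right this (by positivity))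
    exact le_of_mul_le_mul_left h' (by positivity)
  -- The weights of `p` and `q` in `I - J / 2 + (∑ (p - q)) / 2`, whose last term is zero.
  set cp : ι → ℝ := fun n => halfErf (ω n) + (1 - Real.exp (-(1 / 4) * ω n ^ 2)) / 2 with hcp
  set cq : ι → ℝ := fun n => halfErf (ω n) - (1 - Real.exp (-(1 / 4) * ω n ^ 2)) / 2 with hcq
  have hsum0 : ∑ n, (p n - q n) = 0 := by
    rw [← h0, commutatorSum]
    simp
  have hIJ : ∑ n, (p n * cp n + q n * cq n) = I - J / 2 := by
    rw [← add_zero (I - J / 2), ← mul_zero (1 / 2 : ℂ), ← hsum0, hI, hJ, Finset.sum_div,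
      Finset.mul_sum, ← Finset.sum_sub_distrib, ← Finset.sum_add_distrib]
    refine Finset.sum_congr rfl fun n _ => ?_
    simp only [hcp, hcq]
    push_cast
    ring
  -- A common bound for the weight errors: the exponential handles `ω ≥ D`, and `δ` handles `|ω| ≤
  -- δ`, where both weights are at most `3|ω| / 4`.
  set η : ℝ := Real.exp (-(1 / 4) * D ^ 2) + δ with hη
  have hterm : ∀ n, ‖(if n ∈ S then p n else 0) - (p n * cp n + q n * cq n)‖
      ≤ η * (‖p n‖ + ‖q n‖) := by
    intro n
    have heD := Real.exp_pos (-(1 / 4) * D ^ 2)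
    have hexp : Real.exp (-(1 / 4) * ω n ^ 2) ≤ 1 := by
      rw [Real.exp_le_one_iff]; nlinarith [sq_nonneg (ω n)]
    have aux : ∀ x y : ℝ, |x| ≤ η → |y| ≤ η → ‖p n * x - q n * y‖ ≤ η * (‖p n‖ + ‖q n‖) := by
      intro x y hx hy
      refine (norm_sub_le _ _).trans ?_
      rw [norm_mul, norm_mul, Complex.norm_real, Complex.norm_real, Real.norm_eq_abs,
        Real.norm_eq_abs]
      nlinarith [mul_le_mul_of_nonneg_left hx (norm_nonneg (p n)),
        mul_le_mul_of_nonneg_left hy (norm_nonneg (q n))]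
    by_cases hn : n ∈ S
    · have hωD := hS n hn
      have h1 := abs_le.1 (abs_half_sub_halfErf_le (hD.trans hωD))
      have h2 : Real.exp (-(1 / 4) * ω n ^ 2) ≤ Real.exp (-(1 / 4) * D ^ 2) := by
        rw [Real.exp_le_exp]; nlinarith
      have h3 := Real.exp_pos (-(1 / 4) * ω n ^ 2)
      rw [if_pos hn]
      convert aux (1 - cp n) (cq n) (abs_le.2 ⟨?_, ?_⟩) (abs_le.2 ⟨?_, ?_⟩) using 2
      · push_cast; ring
      all_goals simp only [hcp, hcq]; linarith
    · have h1 := abs_le.1 (abs_halfErf_le (ω n))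
      have h2 := hSc n hn
      have h3 := one_sub_exp_neg_sq_le (x := |ω n| / 2) (by positivity)
      rw [div_pow, sq_abs, show -(ω n ^ 2 / 2 ^ 2) = -(1 / 4) * ω n ^ 2 by ring] at h3
      rw [if_neg hn]
      convert aux (-cp n) (cq n) (abs_le.2 ⟨?_, ?_⟩) (abs_le.2 ⟨?_, ?_⟩) using 2
      · push_cast; ring
      all_goals simp only [hcp, hcq]; linarith
  have herr : ‖∑ n ∈ S, p n - (I - J / 2)‖ ≤ 2 * M * η := by
    have hite : ∑ n ∈ S, p n = ∑ n, if n ∈ S then p n else 0 := by simp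
    rw [← hIJ, hite, ← Finset.sum_sub_distrib]
    refine (norm_sum_le_of_le _ fun n _ => hterm n).trans ?_
    rw [← Finset.mul_sum, Finset.sum_add_distrib]
    have : 0 ≤ η := by positivity
    nlinarith
  have hJ2 : ‖J / 2‖ = ‖J‖ / 2 := by simp
  have h1 := norm_sub_le I (J / 2)
  have h2 : ‖∑ n ∈ S, p n‖ ≤ ‖∑ n ∈ S, p n - (I - J / 2)‖ + ‖I - J / 2‖ := by
    simpa using norm_add_le (∑ n ∈ S, p n - (I - J / 2)) (I - J / 2)
  have h3 : 0 ≤ M * κ := by positivity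
  have h4 : 0 ≤ M * Real.exp (-T ^ 2) := by positivity
  rw [hη] at herr
  nlinarith

end

/-! ### Eigenbases and exponentials of operators. -/

section

variable {E : Type*} [NormedAddCommGroup E] [InnerProductSpace ℂ E]

/-- Orthonormal eigenvectors of a self-adjoint operator extend to an orthonormal eigenbasis. -/
theorem exists_eigenbasis_extending [FiniteDimensional ℂ E] {H : E →L[ℂ] E}
    (hH : IsSelfAdjoint H) {k : ℕ} {e : Fin k → ℝ} {ψ : Fin k → E} (hψ : Orthonormal ℂ ψ)
    (he : ∀ a, H (ψ a) = (e a : ℂ) • ψ a) :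
    ∃ (m : ℕ) (b : OrthonormalBasis (Fin k ⊕ Fin m) ℂ E) (ev : Fin k ⊕ Fin m → ℝ),
      (∀ n, H (b n) = (ev n : ℂ) • b n) ∧ (∀ a, b (Sum.inl a) = ψ a) ∧
        ∀ a, ev (Sum.inl a) = e a := by
  set W : Submodule ℂ E := (Submodule.span ℂ (Set.range ψ))ᗮ with hW
  -- The orthogonal complement of the given eigenvectors is invariant under the symmetric `H`, so
  -- `H` is diagonalised there separately.
  have hsymm : (H : E →ₗ[ℂ] E).IsSymmetric := ContinuousLinearMap.isSelfAdjoint_iff_isSymmetric.1 hH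
  have hmem : ∀ x, x ∈ W ↔ ∀ a, inner ℂ (ψ a) x = 0 := by
    intro x
    rw [hW, Submodule.mem_orthogonal]
    refine ⟨fun h a => h _ (Submodule.subset_span ⟨a, rfl⟩), fun h u hu => ?_⟩
    induction hu using Submodule.span_induction with
    | mem u hu => obtain ⟨a, rfl⟩ := hu; exact h a
    | zero => simp
    | add u w _ _ hu hw => rw [inner_add_left, hu, hw, add_zero]
    | smul c u _ hu => rw [inner_smul_left, hu, mul_zero]
  have hinv : ∀ x ∈ W, (H : E →ₗ[ℂ] E) x ∈ W := by
    intro x hx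
    rw [hmem] at hx ⊢
    intro a
    have h1 : inner ℂ (H (ψ a)) x = inner ℂ (ψ a) (H x) := hsymm (ψ a) x
    change inner ℂ (ψ a) (H x) = 0
    rw [← h1, he, inner_smul_left, hx, mul_zero]
  have hres := hsymm.restrict_invariant hinv
  set φ := hres.eigenvectorBasis rfl
  have hφ : ∀ j, H (φ j : E) = (hres.eigenvalues rfl j : ℂ) • (φ j : E) := by
    intro j
    exact congrArg Subtype.val (hres.apply_eigenvectorBasis rfl j)
  have hon : Orthonormal ℂ (Sum.elim ψ fun j => (φ j : E)) := by
    rw [orthonormal_iff_ite]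
    have hφo : Orthonormal ℂ fun j => (φ j : E) := φ.orthonormal.comp_linearIsometry W.subtypeₗᵢ
    have hφψ : ∀ a j, inner ℂ (ψ a) (φ j : E) = 0 := fun a j => (hmem _).1 (φ j).2 a
    rintro (a | i) (c | j)
    · simpa using orthonormal_iff_ite.1 hψ a c
    · simpa using hφψ a j
    · simpa using inner_eq_zero_symm.1 (hφψ c i)
    · simpa using orthonormal_iff_ite.1 hφo i j
  have hspan : (Submodule.span ℂ (Set.range (Sum.elim ψ fun j => (φ j : E))))ᗮ = ⊥ := by
    rw [Submodule.eq_bot_iff]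
    intro x hx
    rw [Submodule.mem_orthogonal] at hx
    have hxW : x ∈ W := (hmem x).2 fun a => hx _ (Submodule.subset_span ⟨Sum.inl a, rfl⟩)
    have h0 : (⟨x, hxW⟩ : W) = 0 := by
      refine φ.repr.injective ?_
      ext j
      rw [map_zero, OrthonormalBasis.repr_apply_apply]
      exact hx _ (Submodule.subset_span ⟨Sum.inr j, rfl⟩)
    exact congrArg Subtype.val h0
  refine ⟨_, OrthonormalBasis.mkOfOrthogonalEqBot hon hspan,
    Sum.elim e (hres.eigenvalues rfl), ?_, ?_, fun a => rfl⟩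
  · rintro (a | j)
    · simpa using he a
    · simpa using hφ j
  · intro a
    simp

theorem exp_apply_of_eigenvector [CompleteSpace E] {K : E →L[ℂ] E} {c : ℂ} {x : E}
    (h : K x = c • x) : NormedSpace.exp K x = Complex.exp c • x := by
  have hpow : ∀ n : ℕ, (K ^ n) x = c ^ n • x := by
    intro n
    induction n with
    | zero => simp
    | succ n ih =>
      rw [pow_succ, mul_apply_eq_comp, h, map_smul, ih, smul_smul, pow_succ, mul_comm]
  have h1 := (NormedSpace.exp_series_hasSum_exp' (𝕂 := ℂ) K).mapL
    (ContinuousLinearMap.apply ℂ E x)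
  have h2 := (NormedSpace.exp_series_hasSum_exp' (𝕂 := ℂ) c).smul_const x
  rw [← Complex.exp_eq_exp_ℂ] at h2
  refine h1.unique ?_
  convert h2 using 2 with n
  simp [hpow, smul_smul]

end

/-! ### Spectral expansion of commutator expectations. -/

section

section

variable {E : Type*} [NormedAddCommGroup E] [InnerProductSpace ℂ E] {ι : Type*} [Fintype ι]

theorem sum_inner_apply_mul_inner [CompleteSpace E] (b : OrthonormalBasis ι ℂ E) (A : E →L[ℂ] E)
    (x y : E) : ∑ n, inner ℂ x (A (b n)) * inner ℂ (b n) y = inner ℂ x (A y) := by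
  simp_rw [← ContinuousLinearMap.adjoint_inner_left A]
  exact b.sum_inner_mul_inner _ _

/-- Cauchy–Schwarz and Parseval, after moving `A` to the left; the bound does not depend on the
dimension. -/
theorem sum_norm_inner_apply_mul_inner_le [CompleteSpace E] (b : OrthonormalBasis ι ℂ E)
    (A : E →L[ℂ] E) (x y : E) :
    ∑ n, ‖inner ℂ x (A (b n)) * inner ℂ (b n) y‖ ≤ ‖A‖ * ‖x‖ * ‖y‖ := by
  simp_rw [← ContinuousLinearMap.adjoint_inner_left A, norm_mul]
  refine (Real.sum_mul_le_sqrt_mul_sqrt _ _ _).trans ?_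
  rw [b.sum_sq_norm_inner_left, b.sum_sq_norm_inner_right, Real.sqrt_sq (norm_nonneg _),
    Real.sqrt_sq (norm_nonneg _)]
  gcongr
  exact (ContinuousLinearMap.le_opNorm _ _).trans_eq
    (by rw [LinearIsometryEquiv.norm_map ContinuousLinearMap.adjoint])

theorem norm_inner_apply_le (K : E →L[ℂ] E) {x : E} (hx : ‖x‖ = 1) :
    ‖inner ℂ x (K x)‖ ≤ ‖K‖ := by
  refine (norm_inner_le_norm _ _).trans ?_
  simpa [hx] using K.le_opNorm x

end

theorem setDist_nonneg {Λ : Type*} [PseudoMetricSpace Λ] (X Y : Finset Λ) : 0 ≤ setDist X Y :=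
  Real.iInf_nonneg fun _ => dist_nonneg

theorem setDist_comm {Λ : Type*} [PseudoMetricSpace Λ] (X Y : Finset Λ) :
    setDist X Y = setDist Y X :=
  Equiv.iInf_congr (Equiv.prodComm X Y) fun _ => dist_comm _ _

variable {Λ : Type*} [Fintype Λ] [DecidableEq Λ] {d : Λ → ℕ}

theorem Interaction.isSelfAdjoint_hamiltonian (Φ : Interaction d) :
    IsSelfAdjoint Φ.hamiltonian :=
  isSelfAdjoint_sum (R := Op d) Finset.univ fun Z _ => Φ.selfAdjoint Z

theorem groundProjector_apply {k : ℕ} (ψ : Fin k → HSpace d) (x : HSpace d) :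
    groundProjector ψ x = ∑ a, inner ℂ (ψ a) x • ψ a := by
  simp [groundProjector]

/-- Matrix elements of a Heisenberg-evolved operator between energy eigenvectors. -/
theorem inner_heisenberg_apply {H : Op d} (hH : IsSelfAdjoint H) (t : ℝ) (O : Op d) {e e' : ℝ}
    {x y : HSpace d} (hx : H x = (e : ℂ) • x) (hy : H y = (e' : ℂ) • y) :
    inner ℂ x (heisenberg H t O y) =
      Complex.exp ((e - e' : ℝ) * t * Complex.I) * inner ℂ x (O y) := by
  have hstar : star (NormedSpace.exp ((Complex.I * (t : ℂ)) • H)) =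
      NormedSpace.exp (-((Complex.I * (t : ℂ)) • H)) := by
    rw [NormedSpace.star_exp, star_smul, hH.star_eq,
      show star (Complex.I * (t : ℂ)) = -(Complex.I * (t : ℂ)) by simp]
    exact congrArg NormedSpace.exp (neg_smul (Complex.I * (t : ℂ)) H)
  have hexp : ∀ {z : HSpace d} {u : ℝ}, H z = (u : ℂ) • z →
      NormedSpace.exp (-((Complex.I * (t : ℂ)) • H)) z =
        Complex.exp (-(Complex.I * t * u)) • z := fun {z u} hz =>
    exp_apply_of_eigenvector (by
      rw [neg_apply, smul_apply, hz, smul_smul, neg_smul])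
  rw [heisenberg, mul_apply_eq_comp, mul_apply_eq_comp,
    ← ContinuousLinearMap.adjoint_inner_left, ← ContinuousLinearMap.star_eq_adjoint, hstar,
    hexp hx, hexp hy, map_smul, inner_smul_left, inner_smul_right, ← mul_assoc,
    ← Complex.exp_conj, ← Complex.exp_add]
  congr 2
  simp
  ring

variable {ι : Type*} [Fintype ι] (b : OrthonormalBasis ι ℂ (HSpace d)) {ev : ι → ℝ} {H : Op d}

theorem inner_commutator_heisenberg_right (hH : IsSelfAdjoint H)
    (hb : ∀ n, H (b n) = (ev n : ℂ) • b n) {x : HSpace d} {e : ℝ} (hx : H x = (e : ℂ) • x)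
    (A B : Op d) (t : ℝ) :
    inner ℂ x ((A * heisenberg H t B - heisenberg H t B * A) x) =
      commutatorSum (fun n => inner ℂ x (A (b n)) * inner ℂ (b n) (B x))
        (fun n => inner ℂ x (B (b n)) * inner ℂ (b n) (A x)) (fun n => ev n - e) t := by
  rw [sub_apply, mul_apply_eq_comp,
    mul_apply_eq_comp, inner_sub_right, ← sum_inner_apply_mul_inner b A,
    ← sum_inner_apply_mul_inner b (heisenberg H t B), commutatorSum, ← Finset.sum_sub_distrib]
  refine Finset.sum_congr rfl fun n _ => ?_
  rw [inner_heisenberg_apply hH t B (hb n) hx, inner_heisenberg_apply hH t B hx (hb n), neg_sub]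
  ring

/-- An eigenstate is stationary, so evolving `A` by `-t` gives the same sum as evolving `B` by `t`.
Lieb–Robinson can thus be applied with either operator as the evolved one. -/
theorem inner_commutator_heisenberg_left (hH : IsSelfAdjoint H)
    (hb : ∀ n, H (b n) = (ev n : ℂ) • b n) {x : HSpace d} {e : ℝ} (hx : H x = (e : ℂ) • x)
    (A B : Op d) (t : ℝ) :
    inner ℂ x ((heisenberg H (-t) A * B - B * heisenberg H (-t) A) x) =
      commutatorSum (fun n => inner ℂ x (A (b n)) * inner ℂ (b n) (B x))
        (fun n => inner ℂ x (B (b n)) * inner ℂ (b n) (A x)) (fun n => ev n - e) t := by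
  rw [sub_apply, mul_apply_eq_comp,
    mul_apply_eq_comp, inner_sub_right, ← sum_inner_apply_mul_inner b B,
    ← sum_inner_apply_mul_inner b (heisenberg H (-t) A), commutatorSum, ← Finset.sum_sub_distrib]
  refine Finset.sum_congr rfl fun n _ => ?_
  rw [inner_heisenberg_apply hH (-t) A (hb n) hx, inner_heisenberg_apply hH (-t) A hx (hb n)]
  have h1 : ((e - ev n : ℝ) : ℂ) * ((-t : ℝ) : ℂ) = (ev n - e : ℝ) * t := by push_cast; ring
  have h2 : ((ev n - e : ℝ) : ℂ) * ((-t : ℝ) : ℂ) = (-(ev n - e) : ℝ) * t := by push_cast; ring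
  rw [h1, h2]
  ring

/-- The Lieb–Robinson bound for the expectation of a commutator in an energy eigenstate; by time
translation the factor `|X|` improves to `min |X| |Y|`. -/
theorem norm_commutatorSum_le_of_liebRobinson [PseudoMetricSpace Λ] (hH : IsSelfAdjoint H)
    (hb : ∀ n, H (b n) = (ev n : ℂ) • b n) {x : HSpace d} {e : ℝ} (hx : H x = (e : ℂ) • x)
    (hx1 : ‖x‖ = 1) {v : ℝ} {g : ℝ → ℝ} (hLR : HasLiebRobinsonBound H v g)
    {X Y : Finset Λ} (hX : X.Nonempty) (hY : Y.Nonempty) (hXY : 0 < setDist X Y) {A B : Op d}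
    (hA : SupportedOn X A) (hB : SupportedOn Y B) {t : ℝ} (ht : |t| ≤ setDist X Y / v) :
    ‖commutatorSum (fun n => inner ℂ x (A (b n)) * inner ℂ (b n) (B x))
        (fun n => inner ℂ x (B (b n)) * inner ℂ (b n) (A x)) (fun n => ev n - e) t‖ ≤
      v * |t| / setDist X Y * g (setDist X Y) * (min X.card Y.card : ℕ) * ‖A‖ * ‖B‖ := by
  rcases min_choice X.card Y.card with h | h <;> rw [h]
  · rw [← inner_commutator_heisenberg_left b hH hb hx]
    refine (norm_inner_apply_le _ hx1).trans ?_
    simpa using hLR X Y hX hY hXY A B hA hB (-t) (by simpa using ht)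
  · rw [← inner_commutator_heisenberg_right b hH hb hx]
    refine (norm_inner_apply_le _ hx1).trans ?_
    rw [setDist_comm] at hXY ht ⊢
    rw [norm_sub_rev]
    exact (hLR Y X hY hX hXY B A hB hA t ht).trans_eq (by ring)

/-! ### Time rescaling and the clustering estimates. -/

theorem commutatorSum_div {κ : Type*} [Fintype κ] (p q : κ → ℂ) (ω : κ → ℝ) (r t : ℝ) :
    commutatorSum p q (fun n => ω n / r) t = commutatorSum p q ω (t / r) := by
  simp only [commutatorSum]
  refine Finset.sum_congr rfl fun n _ => ?_
  congr 4 <;> push_cast <;> ring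

/-- Exponential clustering above a spectral gap, for several ground states. -/
theorem groundStates_clustering [PseudoMetricSpace Λ] (hH : IsSelfAdjoint H) {v ΔE δ : ℝ}
    {g : ℝ → ℝ} (hv : 0 < v) (hg : ∀ r, 0 ≤ r → 0 ≤ g r) (hΔE : 0 < ΔE)
    (hLR : HasLiebRobinsonBound H v g) {X Y : Finset Λ} (hX : X.Nonempty) (hY : Y.Nonempty)
    {A B : Op d} (hA : SupportedOn X A) (hB : SupportedOn Y B) {k : ℕ} {e : Fin k → ℝ}
    {ψ : Fin k → HSpace d} (hψ : AreGroundStates H e ψ ΔE) (hδ : ∀ b c, |e b - e c| ≤ δ)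
    (a : Fin k) :
    ‖inner ℂ (ψ a) (A (B (ψ a))) - inner ℂ (ψ a) (A (groundProjector ψ (B (ψ a))))‖ ≤
      10 * (Real.exp (-(setDist X Y * ΔE / (2 * v))) +
        (min X.card Y.card : ℕ) * g (setDist X Y)) * ‖A‖ * ‖B‖ +
      10 * (δ / ΔE) * √(setDist X Y * ΔE / v) * ‖A‖ * ‖B‖ := by
  obtain ⟨hon, he, hgap⟩ := hψ
  obtain ⟨m, b, ev, hb, hbψ, hev⟩ := exists_eigenbasis_extending hH hon he
  have hδ0 : 0 ≤ δ := (abs_nonneg _).trans (hδ a a)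
  have hψ1 : ‖ψ a‖ = 1 := hon.1 a
  set l := setDist X Y with hl
  have hl0 : 0 ≤ l := setDist_nonneg X Y
  set κ : ℝ := (min X.card Y.card : ℕ) * g l with hκ
  have hκ0 : 0 ≤ κ := mul_nonneg (Nat.cast_nonneg _) (hg l hl0)
  set p : Fin k ⊕ Fin m → ℂ := fun n => inner ℂ (ψ a) (A (b n)) * inner ℂ (b n) (B (ψ a)) with hp
  set q : Fin k ⊕ Fin m → ℂ := fun n => inner ℂ (ψ a) (B (b n)) * inner ℂ (b n) (A (ψ a)) with hq
  have hpM : ∑ n, ‖p n‖ ≤ ‖A‖ * ‖B‖ := by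
    refine (sum_norm_inner_apply_mul_inner_le b A (ψ a) (B (ψ a))).trans ?_
    have := B.le_opNorm (ψ a)
    rw [hψ1, mul_one] at this ⊢
    gcongr
  have hqM : ∑ n, ‖q n‖ ≤ ‖A‖ * ‖B‖ := by
    refine (sum_norm_inner_apply_mul_inner_le b B (ψ a) (A (ψ a))).trans ?_
    have := A.le_opNorm (ψ a)
    rw [hψ1, mul_one] at this ⊢
    rw [mul_comm]
    gcongr
  have hQ : inner ℂ (ψ a) (A (B (ψ a))) - inner ℂ (ψ a) (A (groundProjector ψ (B (ψ a)))) =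
      ∑ n ∈ Finset.univ.map Function.Embedding.inr, p n := by
    rw [← sum_inner_apply_mul_inner b A, groundProjector_apply, map_sum, inner_sum,
      Fintype.sum_sum_type, Finset.sum_map, sub_eq_iff_eq_add, add_comm]
    refine congrArg₂ _ rfl (Finset.sum_congr rfl fun c _ => ?_)
    rw [map_smul, inner_smul_right, hbψ, mul_comm]
  rw [hQ]
  set ε := Real.exp (-(l * ΔE / (2 * v))) with hε
  have hε0 : 0 < ε := Real.exp_pos _
  have hM : 0 ≤ ‖A‖ * ‖B‖ := by positivity
  have hs0 : 0 ≤ (δ / ΔE) * √(l * ΔE / v) := by positivity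
  suffices h : ‖∑ n ∈ Finset.univ.map Function.Embedding.inr, p n‖ ≤
      ‖A‖ * ‖B‖ * (2 * κ + 10 * ε + 4 * ((δ / ΔE) * √(l * ΔE / v))) by
    nlinarith [mul_nonneg hM hκ0, mul_nonneg hM hs0]
  -- When `lΔE / v < 1` the exponential is at least `1 / 2`, so the trivial bound suffices;
  -- otherwise `l > 0` and `T ≥ 1 / 2` below.
  rcases lt_or_ge (l * ΔE / v) 1 with hμ | hμ
  · have h1 : ‖∑ n ∈ Finset.univ.map Function.Embedding.inr, p n‖ ≤ ‖A‖ * ‖B‖ :=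
      ((norm_sum_le _ _).trans (Finset.sum_le_sum_of_subset_of_nonneg (Finset.subset_univ _)
        fun n _ _ => norm_nonneg _)).trans hpM
    have h2 : 1 / 2 ≤ ε := by
      have h3 : l * ΔE / (2 * v) = l * ΔE / v / 2 := by ring
      have := Real.add_one_le_exp (-(l * ΔE / (2 * v)))
      rw [h3] at this
      rw [hε, h3]
      linarith
    refine h1.trans (le_mul_of_one_le_right hM ?_)
    linarith
  have hl1 : 0 < l := by
    rcases hl0.eq_or_lt with h | h
    · rw [← h] at hμ; simp at hμ; linarith
    · exact h
  -- This scale balances the tail exponent `T²` and the filter exponent `D² / 4`: with `T = rl / v`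
  -- and `D = ΔE / r`, both equal `lΔE / (2v)`.
  set r := √(ΔE * v / (2 * l)) with hr
  have hr0 : 0 < r := by positivity
  have hr2 : r ^ 2 = ΔE * v / (2 * l) := Real.sq_sqrt (by positivity)
  have hT2 : (r * l / v) ^ 2 = l * ΔE / (2 * v) := by
    rw [div_pow, mul_pow, hr2]; field_simp
  have hD2 : (1 / 4) * (ΔE / r) ^ 2 = l * ΔE / (2 * v) := by
    rw [div_pow, hr2]; field_simp; ring
  have hδr : δ / r ≤ 2 * ((δ / ΔE) * √(l * ΔE / v)) := by
    have h1 : 1 / r ≤ 2 * (1 / ΔE * √(l * ΔE / v)) := by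
      refine (sq_le_sq₀ (by positivity) (by positivity)).1 ?_
      rw [mul_pow, mul_pow, Real.sq_sqrt (by positivity), div_pow, hr2]
      have h2 : (1 : ℝ) ^ 2 / (ΔE * v / (2 * l)) = 2 * (l / (ΔE * v)) := by field_simp
      have h3 : (2 : ℝ) ^ 2 * ((1 / ΔE) ^ 2 * (l * ΔE / v)) = 4 * (l / (ΔE * v)) := by
        field_simp
        norm_num
      rw [h2, h3]
      have : 0 ≤ l / (ΔE * v) := by positivity
      linarith
    calc δ / r = δ * (1 / r) := by ring
      _ ≤ δ * (2 * (1 / ΔE * √(l * ΔE / v))) := by gcongr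
      _ = _ := by ring
  have main := norm_sum_le_of_commutatorSum_le (p := p) (q := q)
    (ω := fun n => (ev n - e a) / r) (S := Finset.univ.map Function.Embedding.inr)
    (M := ‖A‖ * ‖B‖) (κ := κ) (T := r * l / v) (D := ΔE / r) (δ := δ / r) hpM hqM hκ0
    (by
      refine (sq_le_sq₀ (by norm_num) (by positivity)).1 ?_
      rw [hT2, show l * ΔE / (2 * v) = l * ΔE / v / 2 by ring]
      linarith)
    (by positivity)
    (fun t ht => by
      rw [commutatorSum_div]
      have ht' : |t / r| ≤ l / v := by
        rw [abs_div, abs_of_pos hr0, div_le_iff₀ hr0]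
        exact ht.trans_eq (by ring)
      refine (norm_commutatorSum_le_of_liebRobinson b hH hb (he a) hψ1 hLR hX hY hl1 hA hB
        ht').trans_eq ?_
      rw [← hl, hκ, abs_div, abs_of_pos hr0]
      field_simp)
    (fun n hn => by
      obtain ⟨j, -, rfl⟩ := Finset.mem_map.1 hn
      have := hgap (ev (Sum.inr j)) (b (Sum.inr j)) (b.orthonormal.ne_zero _) (hb _)
        (fun c => by
          rw [← hbψ c]
          exact b.orthonormal.2 (by simp)) a
      change ΔE / r ≤ (ev (Sum.inr j) - e a) / r
      gcongr
      linarith)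
    (by positivity)
    (fun n hn => by
      rcases n with c | j
      · rw [hev, abs_div, abs_of_pos hr0]
        gcongr
        exact hδ c a
      · exact absurd (Finset.mem_map.2 ⟨j, Finset.mem_univ _, rfl⟩) hn)
  rw [neg_mul, hT2, hD2, ← hε] at main
  refine main.trans (mul_le_mul_of_nonneg_left ?_ hM)
  linarith

/-- A unique gapped ground state is the case `k = 1` of several ground states. -/
theorem IsUniqueGroundState.areGroundStates {E₀ ΔE : ℝ} {ψ₀ : HSpace d}
    (h : IsUniqueGroundState H E₀ ψ₀ ΔE) :
    AreGroundStates H (fun _ : Fin 1 => E₀) (fun _ => ψ₀) ΔE := by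
  obtain ⟨h1, h2, h3⟩ := h
  exact ⟨⟨fun _ => h1, fun i j hij => absurd (Subsingleton.elim i j) hij⟩, fun _ => h2,
    fun e φ hφ he ho _ => h3 e φ hφ he (ho 0)⟩

end

end QuantumLattice

open QuantumLattice in
theorem theorem2 :
    ∃ C : ℝ, 0 < C ∧
      ∀ (Λ : Type*) [Fintype Λ] [DecidableEq Λ] [PseudoMetricSpace Λ] (d : Λ → ℕ)
        (Φ : Interaction d) (v : ℝ) (g : ℝ → ℝ) (ΔE : ℝ),
        0 < v → (∀ r, 0 ≤ r → 0 ≤ g r) → 0 < ΔE →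
        HasLiebRobinsonBound Φ.hamiltonian v g →
        ∀ (X Y : Finset Λ), X.Nonempty → Y.Nonempty →
        ∀ (A B : Op d), SupportedOn X A → SupportedOn Y B →
          -- a unique ground state
          (∀ (E₀ : ℝ) (ψ₀ : HSpace d), IsUniqueGroundState Φ.hamiltonian E₀ ψ₀ ΔE →
            ‖inner ℂ ψ₀ (A (B ψ₀)) - inner ℂ ψ₀ (A ψ₀) * inner ℂ ψ₀ (B ψ₀)‖ ≤
              C * (Real.exp (-(setDist X Y * ΔE / (2 * v))) +
                (min X.card Y.card : ℕ) * g (setDist X Y)) * ‖A‖ * ‖B‖) ∧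
          -- several ground states, with energies that differ by at most `δ`
          (∀ (k : ℕ) (E : Fin k → ℝ) (ψ : Fin k → HSpace d) (δ : ℝ),
            AreGroundStates Φ.hamiltonian E ψ ΔE → (∀ b c, |E b - E c| ≤ δ) →
            ∀ a : Fin k,
              ‖inner ℂ (ψ a) (A (B (ψ a))) -
                  inner ℂ (ψ a) (A (groundProjector ψ (B (ψ a))))‖ ≤
                C * (Real.exp (-(setDist X Y * ΔE / (2 * v))) +
                    (min X.card Y.card : ℕ) * g (setDist X Y)) * ‖A‖ * ‖B‖ +
                  C * (δ / ΔE) * Real.sqrt (setDist X Y * ΔE / v) * ‖A‖ * ‖B‖) := by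
  refine ⟨10, by norm_num, fun Λ _ _ _ d Φ v g ΔE hv hg hΔE hLR X Y hX hY A B hA hB => ?_⟩
  have hH := Φ.isSelfAdjoint_hamiltonian
  refine ⟨fun E₀ ψ₀ h => ?_, fun k E ψ δ h hδ a =>
    groundStates_clustering hH hv hg hΔE hLR hX hY hA hB h hδ a⟩
  -- With one state the energy spread is `δ = 0`, which removes the square-root term.
  have := groundStates_clustering hH hv hg hΔE hLR hX hY hA hB h.areGroundStates
    (δ := 0) (fun _ _ => by simp) 0
  simpa [groundProjector_apply, inner_smul_right, mul_comm] using this
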